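/- Let $k$ be a field, let $n,p\ge 0$, let $A=\{\mathbf a_1,\dots,\mathbf a_p\}$ be a finite family of vectors in $\mathbb N^n$, and let $\mathbf b\in\mathbb N^n$. For a finite family $D=\{\mathbf d_j\}_{j\in J}$ in $\mathbb N^n$ let $\varphi_D\colon k[z_j: j\in J]\to k[t_1,\dots,t_n]$ be the $k$-algebra homomorphism with $\varphi_D(z_j)=t^{\mathbf d_j}$, let $I_D=\ker\varphi_D$, and let $k[D]=\operatorname{im}\varphi_D\cong k[z_j: j\in J]/I_D$ be the semigroup ring of $\langle D\rangle$. Its depth, $\operatorname{depth} k[D]$, is the maximal length of a $k[D]$-regular sequence in the graded maximal ideal of $k[D]$, i.e. the ideal spanned by the monomials $t^{\mathbf c}$ with $0\ne\mathbf c\in\langle D\rangle$. A ring is Cohen–Macaulay if it is Noetherian and all its localizations at prime ideals have depth equal to Krull dimension. Let $k_1,k_2$ be positive integers and let $C=k_1A\cup\{k_2\mathbf b\}$, i.e. the family $k_1\mathbf a_1,\dots,k_1\mathbf a_p,k_2\mathbf b$ with corresponding variables $x_1,\dots,x_p,y$. Assume that $\langle C\rangle$ is a gluing of $\langle A\rangle$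 and $\langle\mathbf b\rangle$, that is, in $k[x_1,\dots,x_p,y]$ one has $$I_C=I_A+I_{\{\mathbf b\}}+\langle\rho\rangle$$ (the extensions of $I_A\subset k[x_1,\dots,x_p]$ and of $I_{\{\mathbf b\}}\subset k[y]$) for some binomial $\rho=x_1^{\alpha_1}\cdots x_p^{\alpha_p}-y^{d}$ whose two monomials are both nonconstant. Then $$\dim k[C]=\dim k[A]\qquad\text{and}\qquad \operatorname{depth}k[C]=\operatorname{depth}k[A],$$ and $k[C]$ is Cohen–Macaulay if and only if $k[A]$ is Cohen–Macaulay. -/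

import Mathlib

namespace SemigroupGluing

noncomputable section

/-- The depth (grade) of a commutative ring `R` in an ideal `I`: the supremum of the lengths of the
`R`-regular sequences all of whose members lie in `I`. -/
def depthIn {R : Type*} [CommRing R] (I : Ideal R) : ℕ∞ :=
  ⨆ rs ∈ {rs : List R | (∀ r ∈ rs, r ∈ I) ∧ RingTheory.Sequence.IsRegular R rs},
    (rs.length : ℕ∞)

/-- A commutative ring is Cohen–Macaulay if it is Noetherian and each of its localizations `R_P` at
a prime ideal `P` is a local ring whose depth (in its maximal ideal) equals its Krull dimension. -/
structure IsCohenMacaulay (R : Type*) [CommRing R] : Prop where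
  isNoetherianRing : IsNoetherianRing R
  depth_eq_dim : ∀ (P : Ideal R) [P.IsPrime],
    (depthIn (IsLocalRing.maximalIdeal (Localization.AtPrime P)) : WithBot ℕ∞) =
      ringKrullDim (Localization.AtPrime P)

variable (k : Type*) [Field k] {n : ℕ} {σ τ : Type*}

/-- For a family `A` of vectors of `ℕⁿ`, the `k`-algebra homomorphism
`φ_A : k[x_j | j ∈ σ] → k[t_1, …, t_n]`, `x_j ↦ t^{a_j} = ∏ i, t_i ^ (a_j)_i`. -/
def toricHom (A : σ → Fin n → ℕ) : MvPolynomial σ k →ₐ[k] MvPolynomial (Fin n) k :=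
  MvPolynomial.aeval fun j => ∏ i, MvPolynomial.X i ^ A j i

/-- The defining ideal `I_A = ker φ_A`. -/
def toricIdeal (A : σ → Fin n → ℕ) : Ideal (MvPolynomial σ k) :=
  RingHom.ker (toricHom k A)

/-- The semigroup ring `k[A]`, as the subalgebra of `k[t_1, …, t_n]` generated by the monomials
`t^{a_j}`, that is, the image of `φ_A`. -/
def semigroupRing (A : σ → Fin n → ℕ) : Subalgebra k (MvPolynomial (Fin n) k) :=
  (toricHom k A).range

/-- The graded (irrelevant) maximal ideal of `k[A]`: the elements without constant term, that is,
the span of the `t^a` with `a` a nonzero element of the semigroup. -/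
def irrelevantIdeal (A : σ → Fin n → ℕ) : Ideal (semigroupRing k A) :=
  (RingHom.ker (MvPolynomial.constantCoeff (σ := Fin n) (R := k))).comap (semigroupRing k A).val

/-- The depth of `k[A]`, taken with respect to its graded maximal ideal. -/
def semigroupRingDepth (A : σ → Fin n → ℕ) : ℕ∞ :=
  depthIn (irrelevantIdeal k A)

/-- The generators `C = k₁A ∪ k₂B`; the variables of the polynomial ring belonging to `C` are the
`x_j` (left summand) and the `y_j` (right summand). -/
def glue (k₁ k₂ : ℕ) (A : σ → Fin n → ℕ) (B : τ → Fin n → ℕ) : σ ⊕ τ → Fin n → ℕ :=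
  Sum.elim (fun j => k₁ • A j) (fun j => k₂ • B j)

/-- For `C = k₁A ∪ k₂B` with positive integers `k₁, k₂`, the semigroup `⟨C⟩` is a gluing of `⟨A⟩` and
`⟨B⟩`: one has `I_C = I_A + I_B + (ρ)` in `k[x, y]` for some binomial `ρ = x^α - y^β`.
Both monomials of `ρ` are nonconstant; if the zero vector is neither in `A` nor in `B`, this only
says that `ρ` is not zero, since `ρ` belongs to `I_C`. -/
def IsGluing (k₁ k₂ : ℕ) (A : σ → Fin n → ℕ) (B : τ → Fin n → ℕ) : Prop :=
  0 < k₁ ∧ 0 < k₂ ∧ ∃ (α : σ →₀ ℕ) (β : τ →₀ ℕ), α ≠ 0 ∧ β ≠ 0 ∧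
    toricIdeal k (glue k₁ k₂ A B) =
      (toricIdeal k A).map (MvPolynomial.rename Sum.inl) ⊔
      (toricIdeal k B).map (MvPolynomial.rename Sum.inr) ⊔
      Ideal.span {MvPolynomial.rename Sum.inl (MvPolynomial.monomial α (1 : k)) -
        MvPolynomial.rename Sum.inr (MvPolynomial.monomial β (1 : k))}

end

end SemigroupGluing

/-! If `b ≠ 0` then `I_{b} = 0`, so the gluing condition says that `k[C]` is `k[A][Y]/(Y^d - m)`,
where `m` is the monomial of `k[A]` with exponent vector `∑ αⱼ aⱼ` and `k[A]` embeds by `t^a ↦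
t^{k₁a}`. The modulus is monic, so `k[C]` is finite and free over `k[A]`. If `b = 0`, the two rings
coincide.

Everything else is transfer along a finite free extension `R → S`. Incomparability, lying over and
going down give equality of dimensions and of heights. Regular sequences extend by flatness.
Conversely, when a regular sequence of `R` in `m` cannot be prolonged, `m` kills a nonzero element
modulo it; this socle survives in `S`, and by the exchange property of regular sequences it bounds
the depth of `S` (`depthIn_eq_of_faithfullyFlat`). That argument needs only a zero-dimensional
fibre, so it serves both the irrelevant ideals and all localizations. -/

namespace SemigroupGluing

open RingTheory.Sequence CategoryTheory Abelian Limits Pointwise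

universe u v

/-! ### Regular sequences, Ext and socles -/

section Exchange

variable {R : Type u} [CommRing R]

/-- `HasRegularSeq I M l`: there is an `M`-regular sequence of length `l` with members in `I`. -/
def HasRegularSeq (I : Ideal R) (M : Type*) [AddCommGroup M] [Module R M] (l : ℕ) : Prop :=
  ∃ rs : List R, rs.length = l ∧ (∀ r ∈ rs, r ∈ I) ∧ IsRegular M rs

lemma HasRegularSeq.congr {I : Ideal R} {M N : Type*} [AddCommGroup M] [Module R M]
    [AddCommGroup N] [Module R N] {l : ℕ} (h : HasRegularSeq I M l) (e : M ≃ₗ[R] N) :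
    HasRegularSeq I N l := by
  obtain ⟨rs, hl, hI, hr⟩ := h
  exact ⟨rs, hl, hI, (e.isRegular_congr rs).1 hr⟩

lemma smul_top_quotSMulTop_ne_top {M : Type*} [AddCommGroup M]
    [Module R M] {I : Ideal R} {r : R} (hr : r ∈ I)
    (hI : I • (⊤ : Submodule R M) ≠ ⊤) :
    I • (⊤ : Submodule R (QuotSMulTop r M)) ≠ ⊤ := by
  by_contra eq
  absurd congrArg (Submodule.comap (Submodule.mkQ _)) eq
  simpa [Submodule.comap_smul_top_of_surjective I _ (Submodule.mkQ_surjective _),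
    Submodule.smul_mono_left ((Ideal.span_singleton_le_iff_mem I).mpr hr),
    ← Submodule.ideal_span_singleton_smul] using hI

/-- Dividing out a regular element of `I` lowers the length of regular sequences in `I` by at most
one. -/
lemma HasRegularSeq.quotSMulTop [IsNoetherianRing R] {I : Ideal R} {M : Type u} [AddCommGroup M]
    [Module R M] [Module.Finite R M] (hI : I • (⊤ : Submodule R M) ≠ ⊤) {l : ℕ} {x : R}
    (hxI : x ∈ I) (hx : IsSMulRegular M x) (h : HasRegularSeq I M (l + 1)) :
    HasRegularSeq I (QuotSMulTop x M) l := by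
  -- Rees: a regular sequence of length `l` exists iff `Ext^i(R/I, M) = 0` for all `i < l`. In the
  -- long exact sequence of multiplication by `x`, `Ext^i(R/I, M/xM)` sits between `Ext^i(R/I, M)`
  -- and `Ext^{i+1}(R/I, M)`.
  have h1 := ((ModuleCat.exists_isRegular_tfae I (l + 1) (ModuleCat.of R M) hI.lt_top).out 3 1).1 h
  have hI' : I • (⊤ : Submodule R (QuotSMulTop x M)) ≠ ⊤ := smul_top_quotSMulTop_ne_top hxI hI
  refine ((ModuleCat.exists_isRegular_tfae I l (ModuleCat.of R (QuotSMulTop x M))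
    hI'.lt_top).out 1 3).1 fun i hi => ?_
  have zero1 := AddCommGrpCat.isZero_of_iff_subsingleton.mpr (h1 i (by omega))
  have zero2 := AddCommGrpCat.isZero_of_iff_subsingleton.mpr (h1 (i + 1) (by omega))
  have hx' : IsSMulRegular (ModuleCat.of R M) x := hx
  exact AddCommGrpCat.subsingleton_of_isZero <| ShortComplex.Exact.isZero_of_both_zeros
    ((Ext.covariant_sequence_exact₃' _ hx'.smulShortComplex_shortExact) i (i + 1) rfl)
    (zero1.eq_zero_of_src _) (zero2.eq_zero_of_tgt _)

lemma HasRegularSeq.quotient_ofList [IsNoetherianRing R] {I : Ideal R} {l : ℕ} (rs : List R) :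
    ∀ {M : Type u} [AddCommGroup M] [Module R M] [Module.Finite R M]
      (_ : I • (⊤ : Submodule R M) ≠ ⊤) (_ : ∀ r ∈ rs, r ∈ I) (_ : IsWeaklyRegular M rs)
      (_ : HasRegularSeq I M (rs.length + l)),
      HasRegularSeq I (M ⧸ (Ideal.ofList rs • ⊤ : Submodule R M)) l := by
  induction rs with
  | nil =>
    intro M _ _ _ hI _ _ h
    rw [List.length_nil, zero_add] at h
    exact h.congr (Submodule.quotEquivOfEqBot _ (by simp)).symm
  | cons r rs ih =>
    intro M _ _ _ hI hrs hreg h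
    rw [isWeaklyRegular_cons_iff] at hreg
    have hr : r ∈ I := hrs r (by simp)
    refine HasRegularSeq.congr ?_ (Submodule.quotOfListConsSMulTopEquivQuotSMulTopInner M r rs).symm
    refine ih (smul_top_quotSMulTop_ne_top hr hI) (fun s hs => hrs s (by simp [hs])) hreg.2 ?_
    refine HasRegularSeq.quotSMulTop hI hr hreg.1 ?_
    rwa [List.length_cons, add_right_comm] at h

/-- A regular sequence in `I` whose quotient has a nonzero element killed by `I` is of maximal
length. -/
lemma length_le_of_socle [IsNoetherianRing R] {I : Ideal R} (hI : I ≠ ⊤) {rs ts : List R}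
    (hrs : ∀ r ∈ rs, r ∈ I) (hreg : IsWeaklyRegular R rs) {u : R} (hu : u ∉ Ideal.ofList rs)
    (huI : ∀ i ∈ I, i * u ∈ Ideal.ofList rs) (hts : ∀ r ∈ ts, r ∈ I) (htreg : IsRegular R ts) :
    ts.length ≤ rs.length := by
  by_contra! hlt
  obtain ⟨l, hl⟩ := Nat.exists_eq_add_of_lt hlt
  have h : HasRegularSeq I R (rs.length + (l + 1)) := ⟨ts, by omega, hts, htreg⟩
  obtain ⟨ys, hy, hyI, hyr⟩ := h.quotient_ofList rs (by simpa using hI) hrs hreg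
  match ys, hy with
  | y :: ys, _ =>
    rw [isRegular_cons_iff] at hyr
    have h0 : (Submodule.Quotient.mk u : R ⧸ (Ideal.ofList rs • ⊤ : Submodule R R)) = 0 := by
      apply hyr.1
      change y • _ = y • _
      rw [smul_zero, ← Submodule.Quotient.mk_smul, Submodule.Quotient.mk_eq_zero]
      simpa using huI y (hyI y (by simp))
    rw [Submodule.Quotient.mk_eq_zero] at h0
    exact hu (by simpa using h0)

/-- If every element of the maximal ideal `m` is a zero divisor modulo `J`, then some nonzero
element modulo `J` is killed by `m`. -/
lemma exists_socle [IsNoetherianRing R] {m J : Ideal R} [m.IsMaximal] (hJ : J ≠ ⊤)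
    (h : ∀ x ∈ m, ¬ IsSMulRegular (R ⧸ J) x) : ∃ u ∉ J, ∀ x ∈ m, x * u ∈ J := by
  have : Nontrivial (R ⧸ J) := Ideal.Quotient.nontrivial_iff.2 hJ
  -- The zero divisors form a finite union of associated primes, so prime avoidance puts `m` inside
  -- one of them, and maximality makes them equal.
  have hexist : ∃ p ∈ associatedPrimes R (R ⧸ J), m ≤ p := by
    obtain ⟨q, hq⟩ := associatedPrimes.nonempty R (R ⧸ J)
    refine (Ideal.subset_union_prime_finite (associatedPrimes.finite R (R ⧸ J)) q q
      fun I hin _ _ ↦ IsAssociatedPrime.isPrime hin).mp ?_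
    rw [biUnion_associatedPrimes_eq_compl_regular R (R ⧸ J)]
    exact fun r hr ↦ h r hr
  obtain ⟨p, hp, hmp⟩ := hexist
  have hpp : p.IsPrime := IsAssociatedPrime.isPrime hp
  obtain rfl := ‹m.IsMaximal›.eq_of_le hpp.ne_top hmp
  obtain ⟨-, v, hv⟩ := isAssociatedPrime_iff.1 (AssociatedPrimes.mem_iff.mp hp)
  obtain ⟨u, rfl⟩ := Ideal.Quotient.mk_surjective v
  have key : ∀ x, x ∈ m ↔ x * u ∈ J := fun x => by
    rw [hv, Submodule.mem_colon_singleton, Submodule.mem_bot, ← Ideal.Quotient.eq_zero_iff_mem]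
    rfl
  exact ⟨u, fun hu => hpp.ne_top ((Ideal.eq_top_iff_one _).2 ((key 1).2 (by simpa using hu))),
    fun x hx => (key x).1 hx⟩

end Exchange

lemma le_depthIn {R : Type*} [CommRing R] {I : Ideal R} {rs : List R} (h : ∀ r ∈ rs, r ∈ I)
    (hr : IsRegular R rs) : (rs.length : ℕ∞) ≤ depthIn I :=
  le_iSup₂_of_le (f := fun (rs : List R) (_ : rs ∈ {rs : List R | (∀ r ∈ rs, r ∈ I) ∧
    IsRegular R rs}) => (rs.length : ℕ∞)) rs ⟨h, hr⟩ le_rfl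

/-- Depth is invariant under faithfully flat extensions along a fibre of dimension zero. -/
theorem depthIn_eq_of_faithfullyFlat {R : Type u} {S : Type v} [CommRing R] [CommRing S]
    [Algebra R S] [IsNoetherianRing R] [IsNoetherianRing S] [Module.FaithfullyFlat R S]
    {m : Ideal R} [m.IsMaximal] {n : Ideal S} (hn : n ≠ ⊤) (hmn : m.map (algebraMap R S) ≤ n)
    (hnm : n ≤ (m.map (algebraMap R S)).radical) : depthIn n = depthIn m := by
  have hmap : ∀ rs : List R, (∀ r ∈ rs, r ∈ m) → ∀ s ∈ rs.map (algebraMap R S), s ∈ n := by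
    intro rs hrs s hs
    obtain ⟨r, hr, rfl⟩ := List.mem_map.1 hs
    exact hmn (Ideal.mem_map_of_mem _ (hrs r hr))
  have hm : m ≠ ⊤ := Ideal.IsMaximal.ne_top ‹_›
  have : Nontrivial R := ⟨⟨0, 1, fun h => hm ((Ideal.eq_top_iff_one m).2 (h ▸ m.zero_mem))⟩⟩
  apply le_antisymm
  · refine iSup₂_le fun ts hts => ?_
    -- A regular sequence in `m` is prolonged one element at a time; getting stuck before length
    -- `ts.length` will contradict the existence of `ts`.
    suffices H : ∀ l ≤ ts.length, HasRegularSeq m R l by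
      obtain ⟨rs, hl, hrm, hr⟩ := H _ le_rfl
      exact hl ▸ le_depthIn hrm hr
    intro l
    induction l with
    | zero => exact fun _ => ⟨[], rfl, by simp, IsRegular.nil R R⟩
    | succ l ih =>
      intro hl
      obtain ⟨rs, hlr, hrm, hr⟩ := ih (by omega)
      have hJ : Ideal.ofList rs ≠ ⊤ :=
        fun h => hm (top_le_iff.1 (h ▸ (Ideal.span_le.2 hrm : Ideal.ofList rs ≤ m)))
      by_cases hx : ∃ x ∈ m, IsSMulRegular (R ⧸ Ideal.ofList rs) x
      · obtain ⟨x, hxm, hx⟩ := hx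
        have hall : ∀ r ∈ rs ++ [x], r ∈ m := by
          simpa [or_imp, forall_and] using ⟨hrm, hxm⟩
        refine ⟨rs ++ [x], by simp [hlr], hall, ?_, ?_⟩
        · rw [isWeaklyRegular_append_iff, isWeaklyRegular_singleton_iff]
          refine ⟨hr.1, ?_⟩
          exact ((Submodule.quotEquivOfEq _ _ (by simp)).isSMulRegular_congr x).1 hx
        · have : Ideal.ofList (rs ++ [x]) ≤ m := Ideal.span_le.2 hall
          intro h
          exact hm (top_le_iff.1 (h.le.trans (by simpa using this)))
      · push Not at hx
        obtain ⟨u, hu, hum⟩ := exists_socle hJ hx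
        set J := Ideal.ofList (rs.map (algebraMap R S)) with hJdef
        have hJmap : (Ideal.ofList rs).map (algebraMap R S) = J := Ideal.map_ofList _ _
        have huJ : algebraMap R S u ∉ J := by
          intro h
          apply hu
          rw [← Ideal.comap_map_eq_self_of_faithfullyFlat (B := S) (Ideal.ofList rs), hJmap]
          exact h
        have hmu : ∀ s ∈ m.map (algebraMap R S), s * algebraMap R S u ∈ J := by
          intro s hs
          have : m.map (algebraMap R S) ≤ J.colon {algebraMap R S u} := by
            rw [Ideal.map_le_iff_le_comap]
            intro x hx
            rw [Ideal.mem_comap, Submodule.mem_colon_singleton, smul_eq_mul, ← map_mul, ← hJmap]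
            exact Ideal.mem_map_of_mem _ (hum x hx)
          simpa [Submodule.mem_colon_singleton] using this hs
        -- The image of `u` is killed modulo `J` by `mS`, hence by a power of `n`. With the least
        -- such power `n ^ (M + 1)`, some `s ∈ n ^ M` makes `s * u` a socle element for `n` itself.
        obtain ⟨N, hN⟩ := Ideal.exists_pow_le_of_le_radical_of_fg hnm
          ((isNoetherianRing_iff_ideal_fg S).1 inferInstance n)
        have hex : ∃ N, ∀ s ∈ n ^ N, s * algebraMap R S u ∈ J := ⟨N, fun s hs => hmu s (hN hs)⟩
        classical
        obtain ⟨M, hM⟩ : ∃ M, Nat.find hex = M + 1 := by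
          refine Nat.exists_eq_succ_of_ne_zero fun h0 => huJ ?_
          have := Nat.find_spec hex 1 (by rw [h0]; simp)
          simpa using this
        have hmin := Nat.find_min hex (m := M) (by omega)
        push Not at hmin
        obtain ⟨s, hs, hsu⟩ := hmin
        have hspec := Nat.find_spec hex
        rw [hM] at hspec
        have := length_le_of_socle hn (hmap rs hrm) hr.1.of_flat hsu
          (fun i hi => by
            rw [← mul_assoc]
            exact hspec _ (by rw [pow_succ']; exact Ideal.mul_mem_mul hi hs)) hts.1 hts.2
        rw [List.length_map] at this
        omega
  · refine iSup₂_le fun rs hrs => ?_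
    have := le_depthIn (hmap rs hrs.1) hrs.2.of_faithfullyFlat
    rwa [List.length_map] at this

/-! ### Flat integral extensions: dimension, height, Cohen–Macaulayness -/

section Integral

variable {R S : Type*} [CommRing R] [CommRing S] [Algebra R S]

lemma exists_liesOver_of_faithfullyFlat [Module.FaithfullyFlat R S] (p : Ideal R)
    [p.IsPrime] : ∃ P : Ideal S, P.IsPrime ∧ P.LiesOver p := by
  obtain ⟨P, hP⟩ := PrimeSpectrum.comap_surjective_of_faithfullyFlat (A := R) (B := S) ⟨p, ‹_›⟩
  exact ⟨P.asIdeal, P.isPrime, ⟨by rw [Ideal.under_def]; exact congrArg (·.asIdeal) hP.symm⟩⟩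

/-- Incomparability gives `≤`; lying over and going down, both from flatness, lift chains and give
`≥`. -/
theorem ringKrullDim_eq_of_isIntegral [Module.FaithfullyFlat R S] [Algebra.IsIntegral R S] :
    ringKrullDim S = ringKrullDim R := by
  apply le_antisymm
  · refine Order.krullDim_le_of_strictMono (PrimeSpectrum.comap (algebraMap R S)) fun P Q h => ?_
    exact Ideal.IsIntegral.comap_lt_comap (R := R) (I := P.asIdeal) (J := Q.asIdeal) h
  · refine iSup_le fun l => ?_
    obtain ⟨Q, hQ, hQl⟩ := exists_liesOver_of_faithfullyFlat (S := S) l.last.asIdeal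
    obtain ⟨L, hL, -⟩ := Ideal.exists_ltSeries_of_hasGoingDown l Q
    rw [← hL]
    exact le_iSup (fun l : LTSeries (PrimeSpectrum S) => ((l.length : ℕ) : WithBot ℕ∞)) L

/-- By incomparability `P` is minimal over `pS`, so the fibre term in the going-down height formula
vanishes. -/
lemma height_eq_of_isIntegral [IsNoetherianRing R] [IsNoetherianRing S] [Module.Flat R S]
    [Algebra.IsIntegral R S] (p : Ideal R) [p.IsPrime] (P : Ideal S) [P.IsPrime] [P.LiesOver p] :
    P.height = p.height := by
  have hP := Ideal.IsIntegral.mem_minimalPrimes_map_under (R := R) P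
  rw [← P.over_def p, Ideal.minimalPrimes_eq_comap] at hP
  obtain ⟨Q, hQ, hQP⟩ := hP
  have hmap : P.map (Ideal.Quotient.mk (p.map (algebraMap R S))) = Q := by
    rw [← hQP, Ideal.map_comap_of_surjective _ Ideal.Quotient.mk_surjective]
  have : Q.IsPrime := hQ.1.1
  rw [Ideal.height_eq_height_add_of_liesOver_of_hasGoingDown p P, hmap,
    Ideal.height_eq_zero_iff.2 hQ, add_zero]

lemma depthIn_localization_eq [IsNoetherianRing R] [IsNoetherianRing S] [Module.Flat R S]
    [Algebra.IsIntegral R S] (p : Ideal R) [p.IsPrime] (P : Ideal S) [P.IsPrime] [P.LiesOver p] :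
    depthIn (IsLocalRing.maximalIdeal (Localization.AtPrime P)) =
      depthIn (IsLocalRing.maximalIdeal (Localization.AtPrime p)) := by
  let _ := Localization.AtPrime.algebraOfLiesOver p P
  have : Module.FaithfullyFlat (Localization.AtPrime p) (Localization.AtPrime P) :=
    Module.FaithfullyFlat.of_flat_of_isLocalHom
  have : IsNoetherianRing (Localization.AtPrime p) :=
    IsLocalization.isNoetherianRing p.primeCompl _ ‹_›
  have : IsNoetherianRing (Localization.AtPrime P) :=
    IsLocalization.isNoetherianRing P.primeCompl _ ‹_›
  refine depthIn_eq_of_faithfullyFlat (Ideal.IsPrime.ne_top') ?_ ?_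
  · exact ((IsLocalRing.local_hom_TFAE (algebraMap (Localization.AtPrime p)
      (Localization.AtPrime P))).out 0 2).mp
        (inferInstance : IsLocalHom (algebraMap (Localization.AtPrime p) (Localization.AtPrime P)))
  · rw [Ideal.radical_eq_sInf]
    refine le_sInf fun Q ⟨hQ, hQp⟩ => ?_
    -- The localization at `P` need not be integral over that at `p`, so incomparability is applied
    -- in `S`, to the contraction of `Q`: it lies inside `P` and over `p`.
    have hcomap : Q.comap (algebraMap S (Localization.AtPrime P)) = P := by
      have hle : Q.comap (algebraMap S (Localization.AtPrime P)) ≤ P := by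
        intro x hx
        rw [← IsLocalization.AtPrime.to_map_mem_maximal_iff (Localization.AtPrime P) P]
        exact IsLocalRing.le_maximalIdeal hQp.ne_top hx
      by_contra hne
      have hlt := Ideal.IsIntegral.comap_lt_comap (R := R) (lt_of_le_of_ne hle hne)
      refine hlt.not_ge fun x hx => ?_
      rw [← Ideal.under_def, ← P.over_def p] at hx
      rw [Ideal.mem_comap, Ideal.mem_comap, ← IsScalarTower.algebraMap_apply R S,
        IsScalarTower.algebraMap_apply R (Localization.AtPrime p)]
      exact hQ (Ideal.mem_map_of_mem _
        ((IsLocalization.AtPrime.to_map_mem_maximal_iff (Localization.AtPrime p) p x).2 hx))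
    rw [← IsLocalization.map_under P.primeCompl (Localization.AtPrime P) Q,
      ← IsLocalization.map_under P.primeCompl (Localization.AtPrime P)
        (IsLocalRing.maximalIdeal _), IsLocalization.AtPrime.under_maximalIdeal _ P,
        Ideal.under_def, hcomap]

theorem isCohenMacaulay_iff_of_isIntegral [IsNoetherianRing R] [IsNoetherianRing S]
    [Module.FaithfullyFlat R S] [Algebra.IsIntegral R S] :
    IsCohenMacaulay S ↔ IsCohenMacaulay R := by
  have key : ∀ (p : Ideal R) [p.IsPrime] (P : Ideal S) [P.IsPrime] [P.LiesOver p],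
      ((depthIn (IsLocalRing.maximalIdeal (Localization.AtPrime P)) : WithBot ℕ∞) =
        ringKrullDim (Localization.AtPrime P)) ↔
      ((depthIn (IsLocalRing.maximalIdeal (Localization.AtPrime p)) : WithBot ℕ∞) =
        ringKrullDim (Localization.AtPrime p)) := by
    intro p _ P _ _
    rw [depthIn_localization_eq p P, IsLocalization.AtPrime.ringKrullDim_eq_height P,
      IsLocalization.AtPrime.ringKrullDim_eq_height p, height_eq_of_isIntegral p P]
  constructor
  · refine fun h => ⟨inferInstance, fun p _ => ?_⟩
    obtain ⟨P, hP, hPp⟩ := exists_liesOver_of_faithfullyFlat (S := S) p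
    exact (key p P).1 (h.depth_eq_dim P)
  · exact fun h => ⟨inferInstance, fun P _ => (key (P.under R) P).2 (h.depth_eq_dim _)⟩

end Integral

noncomputable section

/-! ### Extensions by a root of `X ^ d - m` -/

section MonicExtension

open Polynomial

variable {P R S : Type*} [CommRing P] [CommRing R] [CommRing S]

/-- Transports the gluing identity `I_C = I_A + (ρ)` from `k[x, y]` to `k[A][Y]`: `π` kills `I_A`
and turns `ρ` into `m - Y^d`. -/
lemma ker_eq_span_X_pow_sub_C (π : P →+* R[X]) (hπ : Function.Surjective π) (F : R[X] →+* S)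
    {I : Ideal P} {ρ : P} (hI : RingHom.ker (F.comp π) = I ⊔ Ideal.span {ρ})
    (hIπ : ∀ f ∈ I, π f = 0) {d : ℕ} {m : R} (hρ : π ρ = C m - X ^ d) :
    RingHom.ker F = Ideal.span {X ^ d - C m} := by
  have hρ' : π ρ = -(X ^ d - C m) := by rw [hρ, neg_sub]
  apply le_antisymm
  · intro g hg
    obtain ⟨f, rfl⟩ := hπ g
    have hf : f ∈ RingHom.ker (F.comp π) := hg
    rw [hI] at hf
    rw [← Ideal.mem_comap]
    refine (?_ : _ ≤ Ideal.comap π _) hf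
    refine sup_le (fun f hf => ?_) ?_
    · rw [Ideal.mem_comap, hIπ f hf]
      exact zero_mem _
    · rw [Ideal.span_singleton_le_iff_mem, Ideal.mem_comap, hρ', neg_mem_iff]
      exact Ideal.mem_span_singleton_self _
  · rw [Ideal.span_singleton_le_iff_mem, ← neg_mem_iff, ← hρ', RingHom.mem_ker]
    have : ρ ∈ RingHom.ker (F.comp π) := hI ▸ Ideal.mem_sup_right (Ideal.mem_span_singleton_self _)
    exact this

lemma pow_eq_of_ker_eq_span {f : R →+* S} {y : S} {d : ℕ} {m : R}
    (h : RingHom.ker (eval₂RingHom f y) = Ideal.span {X ^ d - C m}) : y ^ d = f m := by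
  have h1 : X ^ d - C m ∈ RingHom.ker (eval₂RingHom f y) :=
    h ▸ Ideal.mem_span_singleton_self _
  rw [RingHom.mem_ker, map_sub, map_pow, sub_eq_zero] at h1
  simpa using h1

variable [Algebra R S]

lemma free_and_finite_of_ker_eq_span {y : S} (hy : Function.Surjective (aeval (R := R) y)) {d : ℕ}
    (hd : d ≠ 0) {m : R} (hker : RingHom.ker (aeval (R := R) y) = Ideal.span {X ^ d - C m}) :
    Module.Free R S ∧ Module.Finite R S := by
  have hmonic := monic_X_pow_sub_C m hd
  have := hmonic.free_quotient
  have := hmonic.finite_quotient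
  let e := ((Ideal.quotientEquivAlgOfEq R hker.symm).trans
    (Ideal.quotientKerAlgEquivOfSurjective hy)).toLinearEquiv
  exact ⟨Module.Free.of_equiv e, Module.Finite.equiv e⟩

lemma free_and_finite_of_surjective_aeval_one (hy : Function.Surjective (aeval (R := R) (1 : S)))
    (hinj : Function.Injective (algebraMap R S)) : Module.Free R S ∧ Module.Finite R S := by
  let e : R ≃ₗ[R] S := LinearEquiv.ofBijective (Algebra.linearMap R S) ⟨hinj, fun s => by
    obtain ⟨p, rfl⟩ := hy s
    refine ⟨p.eval 1, ?_⟩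
    rw [← map_one (algebraMap R S), aeval_algebraMap_apply_eq_algebraMap_eval,
      Algebra.linearMap_apply]⟩
  exact ⟨Module.Free.of_equiv e, Module.Finite.equiv e⟩

theorem dim_depth_isCohenMacaulay_of_free [IsNoetherianRing R] [IsNoetherianRing S]
    [Module.Free R S] [Module.Finite R S] (m : Ideal R) [m.IsMaximal] {n : Ideal S} (hn : n ≠ ⊤)
    (hmn : m.map (algebraMap R S) ≤ n) (hnm : n ≤ (m.map (algebraMap R S)).radical) :
    ringKrullDim S = ringKrullDim R ∧ depthIn n = depthIn m ∧
      (IsCohenMacaulay S ↔ IsCohenMacaulay R) := by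
  have : Nontrivial S := ⟨⟨0, 1, fun h => hn ((Ideal.eq_top_iff_one n).2 (h ▸ n.zero_mem))⟩⟩
  exact ⟨ringKrullDim_eq_of_isIntegral, depthIn_eq_of_faithfullyFlat hn hmn hnm,
    isCohenMacaulay_iff_of_isIntegral⟩

end MonicExtension

variable (k : Type*) [Field k] {n : ℕ} {σ τ : Type*}

/-! ### Semigroup rings and their augmentation -/

section Irrelevant

variable (A : σ → Fin n → ℕ)

/-- The surjection `k[x] → k[A]`. -/
def toSemigroupRing : MvPolynomial σ k →ₐ[k] semigroupRing k A :=
  (toricHom k A).rangeRestrict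

lemma toSemigroupRing_surjective : Function.Surjective (toSemigroupRing k A) :=
  (toricHom k A).rangeRestrict_surjective

lemma toSemigroupRing_eq_zero_iff {f : MvPolynomial σ k} :
    toSemigroupRing k A f = 0 ↔ f ∈ toricIdeal k A :=
  Subtype.ext_iff

lemma isNoetherianRing_semigroupRing [Finite σ] : IsNoetherianRing (semigroupRing k A) :=
  isNoetherianRing_of_surjective _ _ (toSemigroupRing k A).toRingHom
    (toSemigroupRing_surjective k A)

/-- The augmentation `k[A] → k`, sending an element to its constant term. -/
def augmentation : semigroupRing k A →+* k :=
  (MvPolynomial.constantCoeff (σ := Fin n) (R := k)).comp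
    (semigroupRing k A).val.toRingHom

lemma mem_irrelevantIdeal {x : semigroupRing k A} :
    x ∈ irrelevantIdeal k A ↔ augmentation k A x = 0 := Iff.rfl

@[simp]
lemma augmentation_algebraMap (c : k) :
    augmentation k A (algebraMap k (semigroupRing k A) c) = c :=
  MvPolynomial.constantCoeff_C (Fin n) c

instance isMaximal_irrelevantIdeal : (irrelevantIdeal k A).IsMaximal :=
  RingHom.ker_isMaximal_of_surjective (augmentation k A)
    fun c => ⟨_, augmentation_algebraMap k A c⟩

lemma sub_augmentation_mem (x : semigroupRing k A) :
    x - algebraMap k _ (augmentation k A x) ∈ irrelevantIdeal k A := by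
  rw [mem_irrelevantIdeal, map_sub, augmentation_algebraMap, sub_self]

end Irrelevant

@[simp]
lemma toricHom_X (A : σ → Fin n → ℕ) (j : σ) :
    toricHom k A (MvPolynomial.X j) = ∏ i, MvPolynomial.X i ^ A j i :=
  MvPolynomial.aeval_X _ _

/-- Setting all variables but `t_i` to `1`, where `b i ≠ 0`, sends `t^b` to the transcendental
element `X ^ b i`. -/
lemma toricIdeal_eq_bot_of_ne_zero {b : Fin n → ℕ} (hb : b ≠ 0) :
    toricIdeal k (fun _ : Fin 1 => b) = ⊥ := by
  obtain ⟨i, hi⟩ := Function.ne_iff.1 hb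
  rw [toricIdeal, RingHom.ker_eq_bot_iff_eq_zero]
  intro f hf
  let F : MvPolynomial (Fin n) k →ₐ[k] Polynomial k :=
    MvPolynomial.aeval fun j => if j = i then Polynomial.X else 1
  have hF : F.comp (toricHom k fun _ : Fin 1 => b) =
      MvPolynomial.aeval fun _ => Polynomial.X ^ b i := by
    ext j : 1
    simp [F, ite_pow, Finset.prod_ite_eq']
  have hind : AlgebraicIndependent k (fun _ : Fin 1 => (Polynomial.X ^ b i : Polynomial k)) := by
    rw [algebraicIndependent_unique_type_iff]
    exact (Polynomial.transcendental_X k).pow (Nat.pos_of_ne_zero hi)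
  refine (injective_iff_map_eq_zero _).1 hind f ?_
  rw [← hF, AlgHom.comp_apply]
  exact (congrArg F hf).trans (map_zero F)

/-! ### The extension `k[A] → k[C]` -/

section Glue

variable (k₁ k₂ : ℕ) (A : σ → Fin n → ℕ) (b : Fin n → ℕ)

/-- Scaling exponents by `k₁` is the substitution `t_i ↦ t_i ^ k₁`; this makes `glueHom` well
defined, and injective for `k₁ > 0`. -/
lemma toricHom_glue_rename (B : τ → Fin n → ℕ) (f : MvPolynomial σ k) :
    toricHom k (glue k₁ k₂ A B) (MvPolynomial.rename Sum.inl f) =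
      MvPolynomial.expand k₁ (toricHom k A f) := by
  have : (toricHom k (glue k₁ k₂ A B)).comp (MvPolynomial.rename Sum.inl) =
      (MvPolynomial.expand k₁).comp (toricHom k A) := by
    ext j : 1
    simp [glue, pow_mul]
  exact DFunLike.congr_fun this f

/-- The homomorphism `k[A] → k[C]`, `t^a ↦ t^{k₁ a}`, for `C = k₁A ∪ k₂B`. -/
def glueHom (B : τ → Fin n → ℕ) :
    semigroupRing k A →ₐ[k] semigroupRing k (glue k₁ k₂ A B) :=
  ((MvPolynomial.expand k₁).comp (semigroupRing k A).val).codRestrict _ <| by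
    rintro ⟨-, f, rfl⟩
    exact ⟨MvPolynomial.rename Sum.inl f, toricHom_glue_rename k k₁ k₂ A B f⟩

lemma glueHom_injective (B : τ → Fin n → ℕ) (h : 0 < k₁) :
    Function.Injective (glueHom k k₁ k₂ A B) := by
  intro x y hxy
  exact Subtype.ext (MvPolynomial.expand_injective h (congrArg Subtype.val hxy))

lemma augmentation_glueHom (B : τ → Fin n → ℕ) (h : 0 < k₁) (x : semigroupRing k A) :
    augmentation k _ (glueHom k k₁ k₂ A B x) = augmentation k A x := by
  obtain ⟨-, f, rfl⟩ := x
  change ((MvPolynomial.constantCoeff (σ := Fin n) (R := k)).comp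
    (MvPolynomial.expand k₁).toRingHom) _ = MvPolynomial.constantCoeff _
  congr 1
  ext j
  · simp
  · simp [h.ne']

/-- The homomorphism `k[x, y] → k[A][Y]`, `x_j ↦ t^{a_j}`, `y ↦ Y`. -/
def toPolynomial : MvPolynomial (σ ⊕ Fin 1) k →ₐ[k] Polynomial (semigroupRing k A) :=
  MvPolynomial.aeval (Sum.elim
    (fun j => Polynomial.C (toSemigroupRing k A (MvPolynomial.X j)))
    (fun _ => Polynomial.X))

lemma toPolynomial_rename_inl (f : MvPolynomial σ k) :
    toPolynomial k A (MvPolynomial.rename Sum.inl f) =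
      Polynomial.C (toSemigroupRing k A f) := by
  have : (toPolynomial k A).comp (MvPolynomial.rename Sum.inl) =
      (Polynomial.CAlgHom (R := k)).comp (toSemigroupRing k A) := by
    ext j : 1
    rw [AlgHom.comp_apply, MvPolynomial.rename_X, toPolynomial, MvPolynomial.aeval_X]
    rfl
  exact DFunLike.congr_fun this f

lemma toPolynomial_surjective : Function.Surjective (toPolynomial k A) := by
  intro g
  induction g using Polynomial.induction_on' with
  | add p q hp hq =>
    obtain ⟨f, rfl⟩ := hp
    obtain ⟨g, rfl⟩ := hq
    exact ⟨f + g, map_add _ _ _⟩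
  | monomial d a =>
    obtain ⟨f, rfl⟩ := toSemigroupRing_surjective k A a
    refine ⟨MvPolynomial.rename Sum.inl f * MvPolynomial.X (Sum.inr 0) ^ d, ?_⟩
    rw [map_mul, toPolynomial_rename_inl, map_pow, ← Polynomial.C_mul_X_pow_eq_monomial]
    simp [toPolynomial]

/-- The element `t^{k₂ b}` of `k[C]`. -/
def glueGen : semigroupRing k (glue k₁ k₂ A fun _ : Fin 1 => b) :=
  toSemigroupRing k _ (MvPolynomial.X (Sum.inr 0))

/-- The homomorphism `k[A][Y] → k[C]`, `t^a ↦ t^{k₁ a}`, `Y ↦ t^{k₂ b}`. -/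
def fromPolynomial :
    Polynomial (semigroupRing k A) →+* semigroupRing k (glue k₁ k₂ A fun _ : Fin 1 => b) :=
  Polynomial.eval₂RingHom (glueHom k k₁ k₂ A _).toRingHom (glueGen k k₁ k₂ A b)

lemma fromPolynomial_toPolynomial (f : MvPolynomial (σ ⊕ Fin 1) k) :
    fromPolynomial k k₁ k₂ A b (toPolynomial k A f) = toSemigroupRing k _ f := by
  induction f using MvPolynomial.induction_on with
  | C a =>
    have h1 : toPolynomial k A (MvPolynomial.C a) = Polynomial.C (algebraMap k _ a) :=
      (toPolynomial k A).commutes a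
    rw [h1]
    refine (Polynomial.eval₂_C _ _).trans ?_
    exact ((glueHom k k₁ k₂ A _).commutes a).trans
      ((toSemigroupRing k _).commutes a).symm
  | add p q hp hq => simp only [map_add, hp, hq]
  | mul_X p j hp =>
    rw [map_mul, map_mul, map_mul, hp]
    congr 1
    rcases j with j | j
    · rw [← MvPolynomial.rename_X (R := k) Sum.inl j, toPolynomial_rename_inl]
      refine (Polynomial.eval₂_C _ _).trans (Subtype.ext ?_)
      exact (toricHom_glue_rename k k₁ k₂ A _ _).symm
    · obtain rfl : j = 0 := Subsingleton.elim _ _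
      rw [toPolynomial, MvPolynomial.aeval_X]
      exact Polynomial.eval₂_X _ _

lemma fromPolynomial_surjective : Function.Surjective (fromPolynomial k k₁ k₂ A b) := by
  intro s
  obtain ⟨f, rfl⟩ := toSemigroupRing_surjective k _ s
  exact ⟨_, fromPolynomial_toPolynomial k k₁ k₂ A b f⟩

lemma augmentation_glueGen (h : 0 < k₂) (hb : b ≠ 0) :
    augmentation k _ (glueGen k k₁ k₂ A b) = 0 := by
  obtain ⟨i, hi⟩ := Function.ne_iff.1 hb
  change MvPolynomial.constantCoeff (toricHom k _ (MvPolynomial.X (Sum.inr 0))) = 0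
  rw [toricHom_X, map_prod]
  refine Finset.prod_eq_zero (Finset.mem_univ i) ?_
  rw [map_pow, MvPolynomial.constantCoeff_X]
  exact zero_pow (by simpa [glue] using ⟨h.ne', hi⟩)

lemma glueGen_zero : glueGen k k₁ k₂ A 0 = 1 := by
  apply Subtype.ext
  change toricHom k _ (MvPolynomial.X (Sum.inr 0)) = 1
  simp [glue]


lemma glue_structure (h : IsGluing k k₁ k₂ A fun _ : Fin 1 => b) (hb : b ≠ 0) :
    ∃ (d : ℕ) (m : semigroupRing k A), d ≠ 0 ∧
      RingHom.ker (fromPolynomial k k₁ k₂ A b) =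
        Ideal.span {Polynomial.X ^ d - Polynomial.C m} := by
  obtain ⟨-, -, α, β, -, hβ, hI⟩ := h
  rw [toricIdeal_eq_bot_of_ne_zero k hb, Ideal.map_bot, sup_bot_eq] at hI
  have hd : β 0 ≠ 0 := fun h0 => hβ (Finsupp.unique_ext (by simpa using h0))
  refine ⟨β 0, toSemigroupRing k A (MvPolynomial.monomial α 1), hd,
    ker_eq_span_X_pow_sub_C (toPolynomial k A).toRingHom (toPolynomial_surjective k A) _
      (I := (toricIdeal k A).map (MvPolynomial.rename Sum.inl))
      (ρ := MvPolynomial.rename Sum.inl (MvPolynomial.monomial α 1) -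
        MvPolynomial.rename Sum.inr (MvPolynomial.monomial β 1)) ?_ ?_ ?_⟩
  · rw [← hI]
    ext f
    rw [← toSemigroupRing_eq_zero_iff, ← fromPolynomial_toPolynomial]
    rfl
  · suffices H : (toricIdeal k A).map (MvPolynomial.rename (Sum.inl : σ → σ ⊕ Fin 1)) ≤
        RingHom.ker (toPolynomial k A) from H
    rw [Ideal.map_le_iff_le_comap]
    intro f hf
    rw [Ideal.mem_comap, RingHom.mem_ker, toPolynomial_rename_inl,
      (toSemigroupRing_eq_zero_iff k A).2 hf]
    exact Polynomial.C_0
  · refine (map_sub (toPolynomial k A) _ _).trans (congrArg₂ _ (toPolynomial_rename_inl k A _) ?_)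
    rw [show β = Finsupp.single 0 (β 0) from Finsupp.unique_ext (by simp),
      ← MvPolynomial.X_pow_eq_monomial, map_pow, map_pow, MvPolynomial.rename_X, toPolynomial,
      MvPolynomial.aeval_X]
    simp

/-- `k[C]` is finite and free over `k[A]`. -/
lemma free_and_finite_of_isGluing (h : IsGluing k k₁ k₂ A fun _ : Fin 1 => b) :
    let _ := (glueHom k k₁ k₂ A fun _ : Fin 1 => b).toRingHom.toAlgebra
    Module.Free (semigroupRing k A) (semigroupRing k (glue k₁ k₂ A fun _ : Fin 1 => b)) ∧
      Module.Finite (semigroupRing k A) (semigroupRing k (glue k₁ k₂ A fun _ : Fin 1 => b)) := by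
  intro _
  have hsurj : Function.Surjective (Polynomial.aeval (R := semigroupRing k A)
    (glueGen k k₁ k₂ A b)) := fromPolynomial_surjective k k₁ k₂ A b
  -- For `b = 0` the ideal of `b` is not zero, but the new generator is `1`, so `k[A] → k[C]` is
  -- bijective.
  by_cases hb : b = 0
  · subst hb
    rw [glueGen_zero] at hsurj
    exact free_and_finite_of_surjective_aeval_one hsurj (glueHom_injective k k₁ k₂ A _ h.1)
  · obtain ⟨d, m, hd, hker⟩ := glue_structure k k₁ k₂ A b h hb
    exact free_and_finite_of_ker_eq_span hsurj hd hker

lemma irrelevantIdeal_map_le (h : 0 < k₁) (B : τ → Fin n → ℕ) :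
    (irrelevantIdeal k A).map (glueHom k k₁ k₂ A B).toRingHom ≤ irrelevantIdeal k _ := by
  rw [Ideal.map_le_iff_le_comap]
  intro x hx
  rw [Ideal.mem_comap, mem_irrelevantIdeal]
  exact (augmentation_glueHom k k₁ k₂ A B h x).trans hx

/-- The constant is `1` if `b = 0` and `0` otherwise. In the latter case the `d`-th power of the
generator is the image of `m`, which has no constant term because the generator has none. -/
lemma glueGen_sub_mem_radical (h : IsGluing k k₁ k₂ A fun _ : Fin 1 => b) :
    ∃ c : k, glueGen k k₁ k₂ A b - algebraMap k _ c ∈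
      ((irrelevantIdeal k A).map (glueHom k k₁ k₂ A fun _ : Fin 1 => b).toRingHom).radical := by
  by_cases hb : b = 0
  · subst hb
    exact ⟨1, by rw [glueGen_zero, map_one, sub_self]; exact zero_mem _⟩
  · obtain ⟨d, m, hd, hker⟩ := glue_structure k k₁ k₂ A b h hb
    have hpow : glueGen k k₁ k₂ A b ^ d = glueHom k k₁ k₂ A _ m := pow_eq_of_ker_eq_span hker
    refine ⟨0, ?_⟩
    rw [map_zero, sub_zero]
    refine ⟨d, ?_⟩
    rw [hpow]
    refine Ideal.mem_map_of_mem (glueHom k k₁ k₂ A fun _ : Fin 1 => b).toRingHom ?_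
    rw [mem_irrelevantIdeal, ← augmentation_glueHom k k₁ k₂ A (fun _ : Fin 1 => b) h.1, ← hpow,
      map_pow, augmentation_glueGen k k₁ k₂ A b h.2.1 hb, zero_pow hd]

lemma irrelevantIdeal_le_radical (h : IsGluing k k₁ k₂ A fun _ : Fin 1 => b) :
    irrelevantIdeal k (glue k₁ k₂ A fun _ : Fin 1 => b) ≤
      ((irrelevantIdeal k A).map (glueHom k k₁ k₂ A fun _ : Fin 1 => b).toRingHom).radical := by
  set J := ((irrelevantIdeal k A).map
    (glueHom k k₁ k₂ A fun _ : Fin 1 => b).toRingHom).radical with hJdef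
  have hJ : J ≤ irrelevantIdeal k _ :=
    (Ideal.IsPrime.radical_le_iff inferInstance).2 (irrelevantIdeal_map_le k k₁ k₂ A h.1 _)
  have hmul : ∀ {s t : semigroupRing k (glue k₁ k₂ A fun _ : Fin 1 => b)},
      (∃ c : k, s - algebraMap k _ c ∈ J) → (∃ c : k, t - algebraMap k _ c ∈ J) →
        ∃ c : k, s * t - algebraMap k _ c ∈ J := by
    rintro s t ⟨c, hc⟩ ⟨e, he⟩
    refine ⟨c * e, ?_⟩
    have : s * t - algebraMap k _ (c * e) = t * (s - algebraMap k _ c) +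
        algebraMap k _ c * (t - algebraMap k _ e) := by
      rw [map_mul]
      ring
    rw [this]
    exact add_mem (J.mul_mem_left _ hc) (J.mul_mem_left _ he)
  -- The elements congruent to a constant modulo `J` are closed under sums and products and contain
  -- the image of `k[A]` and the new generator, so they exhaust `k[C]`. For an element of the
  -- irrelevant ideal the constant is `0`.
  have key : ∀ p : Polynomial (semigroupRing k A),
      ∃ c : k, fromPolynomial k k₁ k₂ A b p - algebraMap k _ c ∈ J := by
    intro p
    induction p using Polynomial.induction_on with
    | C a =>
      refine ⟨augmentation k A a, Ideal.le_radical ?_⟩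
      have h1 : fromPolynomial k k₁ k₂ A b (Polynomial.C a) = glueHom k k₁ k₂ A _ a :=
        Polynomial.eval₂_C _ _
      rw [h1, ← (glueHom k k₁ k₂ A fun _ : Fin 1 => b).commutes, ← map_sub]
      exact Ideal.mem_map_of_mem (glueHom k k₁ k₂ A fun _ : Fin 1 => b).toRingHom
        (sub_augmentation_mem k A a)
    | add p q hp hq =>
      obtain ⟨c, hc⟩ := hp
      obtain ⟨e, he⟩ := hq
      refine ⟨c + e, ?_⟩
      rw [map_add, map_add, add_sub_add_comm]
      exact add_mem hc he
    | monomial d a ih =>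
      rw [pow_succ, ← mul_assoc, map_mul]
      refine hmul ih ?_
      have h1 : fromPolynomial k k₁ k₂ A b Polynomial.X = glueGen k k₁ k₂ A b :=
        Polynomial.eval₂_X _ _
      rw [h1]
      exact glueGen_sub_mem_radical k k₁ k₂ A b h
  intro s hs
  obtain ⟨p, rfl⟩ := fromPolynomial_surjective k k₁ k₂ A b s
  obtain ⟨c, hc⟩ := key p
  have h0 := hJ hc
  rw [mem_irrelevantIdeal, map_sub, (mem_irrelevantIdeal k _).1 hs, augmentation_algebraMap,
    zero_sub, neg_eq_zero] at h0
  rwa [h0, map_zero, sub_zero] at hc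

end Glue

end
end SemigroupGluing

theorem corollary3p6 (k : Type*) [Field k] {n p : ℕ} (A : Fin p → Fin n → ℕ) (b : Fin n → ℕ)
    (k₁ k₂ : ℕ)
    (h : SemigroupGluing.IsGluing k k₁ k₂ A (fun _ : Fin 1 => b)) :
    let C : Fin p ⊕ Fin 1 → Fin n → ℕ := SemigroupGluing.glue k₁ k₂ A (fun _ : Fin 1 => b)
    ringKrullDim (SemigroupGluing.semigroupRing k C) =
        ringKrullDim (SemigroupGluing.semigroupRing k A) ∧
      SemigroupGluing.semigroupRingDepth k C = SemigroupGluing.semigroupRingDepth k A ∧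
      (SemigroupGluing.IsCohenMacaulay (SemigroupGluing.semigroupRing k C) ↔
        SemigroupGluing.IsCohenMacaulay (SemigroupGluing.semigroupRing k A)) := by
  intro C
  let _ := (SemigroupGluing.glueHom k k₁ k₂ A fun _ : Fin 1 => b).toRingHom.toAlgebra
  obtain ⟨hfree, hfin⟩ := SemigroupGluing.free_and_finite_of_isGluing k k₁ k₂ A b h
  have := SemigroupGluing.isNoetherianRing_semigroupRing k A
  have := SemigroupGluing.isNoetherianRing_semigroupRing k C
  exact SemigroupGluing.dim_depth_isCohenMacaulay_of_free (SemigroupGluing.irrelevantIdeal k A)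
    (Ideal.IsPrime.ne_top inferInstance) (SemigroupGluing.irrelevantIdeal_map_le k k₁ k₂ A h.1 _)
    (SemigroupGluing.irrelevantIdeal_le_radical k k₁ k₂ A b h)
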